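/- **Setting.** Let $D>0$ be the peak-age threshold, $[0,T]$ the (known) time horizon with $T>0$, and $0\le\Delta_0<D$ the age of information at time $0$; put $t_0=-\Delta_0$. An arrival sequence $\sigma$ consists of finitely many packets $1,\dots,n$, with generation times $0\le t_1\le\dots\le t_n<T$ and arbitrary sizes $w_1,\dots,w_n>0$ (in bits), such that $t_i-t_{i-1}<D$ for $1\le i\le n$ and $T-t_n<D$. A policy chooses at each time $t\in[0,T)$ at most one packet to transmit and a speed $s(t)\ge 0$ (in bits per unit of time). A packet is delivered when all its bits have been transmitted. With $\mu(t)$ the largest generation time among $t_0$ and the packets delivered until (and including) time $t$, the age of information is $\Delta(t)=t-\mu(t)$. A policy (possibly knowing $\sigma$ in advance) is *feasible* for $\sigma$ if packets are transmitted only after their generation and in first-come-first-serve order (a packet is transmitted only when all preceding packets have been delivered), $\Delta(t)<D$ for all $t\in[0,T]$, and all $n$ packets are delivered by time $T$. Its energy is $\int_0^T P(s(t))\,dt$. The competitive ratio of a policy is the supremum over all $\sigma$ of its energy divided by the infimum of the energies of all feasible policies for $\sigma$ (with $0/0$ read as $0$ if $n=0$). **Modified greedy policy.** Packet $i$ has the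 deadline $\bar d_i=\min\{t_{i-1}+D,\,T\}$. At any time $t$, the policy transmits, among the available packets (generated until time $t$ and not yet delivered), the one with the earliest deadline (ties in order of generation), at speed $$s(t)=\max_{i}\frac{w(t,\bar d_i)}{\bar d_i-t},$$ where $i$ ranges over the packets available at time $t$ and $w(t,d)$ is the total number of not yet transmitted bits, at time $t$, of the available packets with deadline at most $d$. If no packet is available, the node is idle. **Theorem.** Let $\alpha>1$ and $P(s)=s^\alpha$. For every $D$, $T$, $\Delta_0$ as above, the modified greedy policy is well defined on every arrival sequence, it is feasible and uses finite energy, and its competitive ratio is at most $\alpha^\alpha$. -/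

import Mathlib

open MeasureTheory Set

namespace PeakAoI

/-- A packet arrival sequence for the peak-age threshold `D`, the horizon `[0, T]` and the initial
age `Δ₀`. There are `n` packets `1, …, n`; in Lean, packet `k` is the index `i : Fin n` with
`i = k - 1`. The generation time of packet `k` is `gen k`, that is `gen i.succ`, and `gen 0 = -Δ₀`
is the generation time of the freshest packet that the monitor holds at time `0`. Hence
`gen i.castSucc` is the generation time of the packet immediately preceding packet `i`. -/
structure Arrivals (D T Δ₀ : ℝ) where
  n : ℕ
  gen : Fin (n + 1) → ℝ
  /-- The packet sizes (in bits), which are arbitrary. -/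
  size : Fin n → ℝ
  gen_zero : gen 0 = -Δ₀
  gen_mono : Monotone gen
  gen_nonneg : ∀ i : Fin n, 0 ≤ gen i.succ
  gen_lt : ∀ i : Fin n, gen i.succ < T
  /-- Inter-generation times are less than `D`. -/
  gap_lt : ∀ i : Fin n, gen i.succ - gen i.castSucc < D
  /-- No gap of length `D` is left at the end of the horizon. -/
  last_gap_lt : T - gen (Fin.last n) < D
  size_pos : ∀ i, 0 < size i

variable {D T Δ₀ : ℝ}

/-- The time by which packet `i` has to be delivered when all packets are delivered within the
horizon in the order of generation: the age of the preceding packet reaches `D` at time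
`gen i.castSucc + D`, and the horizon ends at time `T`. -/
noncomputable def Arrivals.deadline (σ : Arrivals D T Δ₀) (i : Fin σ.n) : ℝ :=
  min (σ.gen i.castSucc + D) T

/-- What a node does: at time `t` it transmits the packet `serve t` (none if `serve t = none`)
at speed `speed t`. -/
structure Schedule (σ : Arrivals D T Δ₀) where
  serve : ℝ → Option (Fin σ.n)
  speed : ℝ → ℝ
  speed_nonneg : ∀ t, 0 ≤ speed t
  measurable_speed : Measurable speed
  measurableSet_serve : ∀ i, MeasurableSet {t | serve t = some i}
  integrable_speed : IntegrableOn speed (Icc 0 T)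

namespace Schedule

variable {σ : Arrivals D T Δ₀}

/-- Number of bits of packet `i` transmitted during `[0, t]`. -/
noncomputable def sent (S : Schedule σ) (i : Fin σ.n) (t : ℝ) : ℝ :=
  ∫ u in Icc 0 t, {u | S.serve u = some i}.indicator S.speed u

/-- All bits of packet `i` have been transmitted until time `t`. -/
def Delivered (S : Schedule σ) (i : Fin σ.n) (t : ℝ) : Prop :=
  σ.size i ≤ S.sent i t

/-- Packet `i` is available at the node at time `t`: generated, but not yet delivered. -/
def Pending (S : Schedule σ) (i : Fin σ.n) (t : ℝ) : Prop :=
  σ.gen i.succ ≤ t ∧ ¬ S.Delivered i t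

/-- `μ(t)`, the generation time of the latest packet delivered to the monitor until time `t`. -/
noncomputable def latest (S : Schedule σ) (t : ℝ) : ℝ :=
  sSup (insert (σ.gen 0) {g | ∃ i, S.Delivered i t ∧ σ.gen i.succ = g})

/-- The age of information at the monitor, `Δ(t) = t - μ(t)`. -/
noncomputable def age (S : Schedule σ) (t : ℝ) : ℝ :=
  t - S.latest t

/-- The energy consumed in `[0, T]` under the power function `P`. -/
noncomputable def energy (P : ℝ → ℝ) (S : Schedule σ) : ENNReal :=
  ∫⁻ t in Icc 0 T, ENNReal.ofReal (P (S.speed t))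

/-- The constraints of the problem: packets are transmitted only after they are generated, in
first-come-first-serve order, the peak age stays below `D`, and all packets are delivered. -/
structure Feasible (S : Schedule σ) : Prop where
  available : ∀ t ∈ Ico 0 T, ∀ i, S.serve t = some i → σ.gen i.succ ≤ t
  fcfs : ∀ t ∈ Ico 0 T, ∀ i, S.serve t = some i → ∀ j < i, S.Delivered j t
  age_lt : ∀ t ∈ Icc 0 T, S.age t < D
  all_delivered : ∀ i, S.Delivered i T

open Classical in
/-- `w(t, d)`: the number of (not yet transmitted) bits at the node at time `t` that belong to
available packets with deadline at most `d`. -/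
noncomputable def backlog (S : Schedule σ) (t d : ℝ) : ℝ :=
  ∑ j with S.Pending j t ∧ σ.deadline j ≤ d, (σ.size j - S.sent j t)

/-- `S` is a run of the modified greedy policy: at any time, the available packet with the earliest
deadline (ties are broken in the order of generation) is transmitted, at the speed
`max_i w(t, deadline i) / (deadline i - t)`, where `i` ranges over the available packets. If no
packet is available, then the node transmits nothing; the supremum over the empty set is `0`. -/
structure IsModifiedGreedy (S : Schedule σ) : Prop where
  serve_iff : ∀ t ∈ Ico 0 T, ∀ i, S.serve t = some i ↔
    S.Pending i t ∧ ∀ j, S.Pending j t →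
      σ.deadline i < σ.deadline j ∨ (σ.deadline i = σ.deadline j ∧ i ≤ j)
  speed_eq : ∀ t ∈ Ico 0 T, S.speed t =
    ⨆ i : {i // S.Pending i t}, S.backlog t (σ.deadline i) / (σ.deadline i - t)

end Schedule

/-- The energy of an optimal offline policy. -/
noncomputable def offlineEnergy (P : ℝ → ℝ) (σ : Arrivals D T Δ₀) : ENNReal :=
  ⨅ (S : Schedule σ) (_ : S.Feasible), S.energy P

/-- The competitive ratio of a policy, given by the set of its runs on each arrival sequence:
the supremum of (energy of the policy) / (optimal offline energy). If there is no packet at all,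
the ratio `0 / 0` is `0` in `ENNReal`. -/
noncomputable def competitiveRatio (P : ℝ → ℝ)
    (policy : ∀ σ : Arrivals D T Δ₀, Set (Schedule σ)) : ENNReal :=
  ⨆ (σ : Arrivals D T Δ₀) (S : Schedule σ) (_ : S ∈ policy σ), S.energy P / offlineEnergy P σ

/-- The modified greedy policy. -/
def modifiedGreedy (σ : Arrivals D T Δ₀) : Set (Schedule σ) :=
  {S | S.IsModifiedGreedy}

end PeakAoI

/-! Under first-come-first-serve, keeping the age below `D` and finishing by `T` means delivering
each packet by its deadline (`age_lt_of_delivered`, `Feasible.delivered_deadline`). This is speed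
scaling with release times and deadlines in the same order.

The greedy speed is obtained by water filling. A packet of size `w i` is poured on top of the speed
planned for its predecessors, raising it on the window `[r i, d i)` to a common level `q i`. Since
deadlines are ordered, the plan from the latest release on is nonincreasing, and its value at each
time is the maximum in the greedy rule (`WaterFill.succ`, `WaterFill.eq_greedySpeed`). Conversely,
the rule depends only on the time and the number of processed bits, and is antitone in the latter;
hence any two speeds obeying it have the same primitive (`processed_eq`).

For the energy, let `s` be the final speed and `v` that of a feasible policy. By convexity, pouring
packet `i` costs at most `α * q i ^ (α - 1) * w i`, and later packets only raise the speed, so `q i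
≤ s` on the window of `i`. The feasible policy sends `w i` bits inside that window. Hence `∫ s ^ α ≤
∑ α * q i ^ (α - 1) * w i ≤ ∫ α * s ^ (α - 1) * v`, and Young's inequality bounds this by `(1 - 1 /
α) ∫ s ^ α + α ^ (α - 1) ∫ v ^ α`. Absorbing the first term gives the factor `α ^ α`. -/

namespace PeakAoI

/-! ### Water filling and its energy. -/

section WaterFilling

/-- There is a level `q` up to which `s` can be filled on `[a, b]` with volume exactly `w`. -/
theorem exists_fill_level {s : ℝ → ℝ} {a b w M : ℝ} (hs : Measurable s) (hs0 : ∀ u, 0 ≤ s u)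
    (hM : ∀ u, s u ≤ M) (hab : a < b) (hw : 0 ≤ w) :
    ∃ q, 0 ≤ q ∧ ∫ u in a..b, max (q - s u) 0 = w := by
  have hbd : ∀ q u, |max (q - s u) 0| ≤ |q| := fun q u => by
    rw [abs_of_nonneg (le_max_right _ _)]
    exact max_le (by linarith [hs0 u, le_abs_self q]) (abs_nonneg q)
  have hmeas : ∀ q, Measurable fun u => max (q - s u) 0 := fun q => by fun_prop
  have hcont : Continuous fun q => ∫ u in a..b, max (q - s u) 0 := by
    refine continuous_iff_continuousAt.2 fun q₀ => ?_
    refine intervalIntegral.continuousAt_of_dominated_interval (bound := fun _ => |q₀| + 1)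
      (.of_forall fun q => (hmeas q).aestronglyMeasurable) ?_ intervalIntegrable_const ?_
    · filter_upwards [Metric.ball_mem_nhds q₀ one_pos] with q hq
      refine .of_forall fun u _ => (hbd q u).trans ?_
      have := abs_sub_abs_le_abs_sub q q₀
      rw [Metric.mem_ball, Real.dist_eq] at hq
      linarith
    · exact .of_forall fun u _ => by fun_prop
  have hM0 : 0 ≤ M := (hs0 0).trans (hM 0)
  -- At this level the filling has height at least `w / (b - a)` everywhere, hence volume at least
  -- `w`.
  have hQ : 0 ≤ M + w / (b - a) := add_nonneg hM0 (div_nonneg hw (sub_nonneg.2 hab.le))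
  have hzero : ∫ u in a..b, max (0 - s u) 0 = 0 := by
    simp [hs0]
  have htop : w ≤ ∫ u in a..b, max (M + w / (b - a) - s u) 0 := by
    have h1 : ∫ _ in a..b, w / (b - a) = w := by
      rw [intervalIntegral.integral_const, smul_eq_mul]
      field_simp [(sub_pos.2 hab).ne']
    refine h1.symm.trans_le ?_
    refine intervalIntegral.integral_mono_on (μ := volume) hab.le intervalIntegrable_const ?_
      fun u _ => le_max_of_le_left (by linarith [hM u])
    exact (intervalIntegrable_const (c := |M + w / (b - a)|)).mono_fun
      (hmeas _).aestronglyMeasurable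
      (.of_forall fun u => by simpa only [Real.norm_eq_abs, abs_abs] using hbd _ u)
  obtain ⟨q, hq, h⟩ := intermediate_value_Icc hQ hcont.continuousOn
    (show w ∈ Icc _ _ from ⟨by simp only [hzero, hw], htop⟩)
  exact ⟨q, hq.1, h⟩

theorem intervalIntegrable_of_bounded {s : ℝ → ℝ} {M : ℝ} (hs : Measurable s)
    (hs0 : ∀ u, 0 ≤ s u) (hM : ∀ u, s u ≤ M) (a b : ℝ) : IntervalIntegrable s volume a b :=
  (intervalIntegrable_const (c := M)).mono_fun hs.aestronglyMeasurable
    (.of_forall fun u => by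
      simpa only [Real.norm_eq_abs, abs_of_nonneg (hs0 u)] using (hM u).trans (le_abs_self M))

/-- `s` is the speed at which the jobs `0, …, n - 1` with release times `r`, deadlines `d` and
works `w` are processed in order, when each new job raises the planned speed to a constant level
on the last part of its time window. -/
structure WaterFill (r d w : ℕ → ℝ) (n : ℕ) (s : ℝ → ℝ) : Prop where
  measurable : Measurable s
  nonneg : ∀ t, 0 ≤ s t
  bounded : ∃ M, ∀ t, s t ≤ M
  eq_zero : ∀ t, (∀ j < n, d j ≤ t) → s t = 0
  antitone : ∀ t u, (∀ j < n, r j ≤ t) → t ≤ u → s u ≤ s t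
  total : ∀ t, 0 ≤ t → (∀ j < n, d j ≤ t) → ∫ u in (0)..t, s u = ∑ j ∈ Finset.range n, w j
  met : ∀ i < n, ∑ j ∈ Finset.range (i + 1), w j ≤ ∫ u in (0)..d i, s u
  rate : ∀ t, 0 ≤ t → ∀ i < n, r i ≤ t → t < d i →
    ∑ j ∈ Finset.range (i + 1), w j - ∫ u in (0)..t, s u ≤ s t * (d i - t)
  critical : ∀ t, 0 ≤ t → (∀ j < n, r j ≤ t) → 0 < s t → ∃ i < n, t < d i ∧
    (∀ u ∈ Ico t (d i), s u = s t) ∧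
      ∫ u in (0)..d i, s u = ∑ j ∈ Finset.range (i + 1), w j
  tight : ∀ t, 0 ≤ t → 0 < s t → ∃ i < n, r i ≤ t ∧ t < d i ∧
    ∑ j ∈ Finset.range (i + 1), w j - ∫ u in (0)..t, s u = s t * (d i - t)

variable {r d w : ℕ → ℝ} {n : ℕ} {s : ℝ → ℝ}

theorem WaterFill.intervalIntegrable (H : WaterFill r d w n s) (a b : ℝ) :
    IntervalIntegrable s volume a b :=
  let ⟨_, hM⟩ := H.bounded
  intervalIntegrable_of_bounded H.measurable H.nonneg hM a b

theorem WaterFill.integral_mono (H : WaterFill r d w n s) {a b : ℝ} (hab : a ≤ b) :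
    ∫ u in (0)..a, s u ≤ ∫ u in (0)..b, s u := by
  rw [← intervalIntegral.integral_add_adjacent_intervals (H.intervalIntegrable 0 a)
    (H.intervalIntegrable a b)]
  linarith [intervalIntegral.integral_nonneg_of_forall (μ := volume) hab H.nonneg]

theorem waterFill_zero : WaterFill r d w 0 fun _ => 0 where
  measurable := measurable_const
  nonneg _ := le_rfl
  bounded := ⟨0, fun _ => le_rfl⟩
  eq_zero _ _ := rfl
  antitone _ _ _ _ := le_rfl
  total := by simp
  met := by simp
  rate := by simp
  critical := by simp
  tight := by simp

/-- Filling up to the level `q` on `[a, b)`. -/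
noncomputable def fillUp (s : ℝ → ℝ) (a b q : ℝ) : ℝ → ℝ :=
  (Ico a b).indicator fun u => max (q - s u) 0

theorem fillUp_nonneg (s : ℝ → ℝ) (a b q t : ℝ) : 0 ≤ fillUp s a b q t :=
  indicator_nonneg (fun _ _ => le_max_right _ _) t

theorem add_fillUp_of_mem {a b q t : ℝ} (ht : t ∈ Ico a b) :
    s t + fillUp s a b q t = max (s t) q := by
  rw [fillUp, indicator_of_mem ht, ← max_add_add_left, add_zero, add_sub_cancel, max_comm]

theorem fillUp_of_notMem {a b q t : ℝ} (ht : t ∉ Ico a b) : fillUp s a b q t = 0 :=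
  indicator_of_notMem ht _

theorem measurable_fillUp (hs : Measurable s) (a b q : ℝ) : Measurable (fillUp s a b q) :=
  Measurable.indicator (by fun_prop) measurableSet_Ico

theorem fillUp_le {a b q : ℝ} (hq : 0 ≤ q) (hs0 : ∀ u, 0 ≤ s u) (t : ℝ) :
    fillUp s a b q t ≤ q :=
  indicator_le' (fun u _ => max_le (by linarith [hs0 u]) hq) (fun _ _ => hq) t

theorem integral_fillUp_eq_zero {a b q t : ℝ} (ht : 0 ≤ t)
    (h : ∀ u ∈ Ico a b, u < t → q ≤ s u) : ∫ u in (0)..t, fillUp s a b q u = 0 := by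
  rw [intervalIntegral.integral_congr_Ioo_of_le (g := fun _ => 0) ht,
    intervalIntegral.integral_zero]
  intro u hu
  by_cases hu' : u ∈ Ico a b
  · rw [fillUp, indicator_of_mem hu', max_eq_right (sub_nonpos.2 (h u hu' hu.2))]
  · exact fillUp_of_notMem hu'

theorem integral_fillUp_of_le {a b q t : ℝ} (hs : Measurable s) (hs0 : ∀ u, 0 ≤ s u)
    (hq : 0 ≤ q) (ha : 0 ≤ a) (hab : a ≤ b) (hbt : b ≤ t) :
    ∫ u in (0)..t, fillUp s a b q u = ∫ u in a..b, max (q - s u) 0 := by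
  have hint := intervalIntegrable_of_bounded (measurable_fillUp hs a b q)
    (fillUp_nonneg s a b q) (fillUp_le hq hs0)
  rw [← intervalIntegral.integral_add_adjacent_intervals (hint 0 a) (hint a t),
    ← intervalIntegral.integral_add_adjacent_intervals (hint a b) (hint b t),
    integral_fillUp_eq_zero ha fun u hu hua => absurd hu.1 hua.not_ge,
    intervalIntegral.integral_congr_Ioo_of_le (f := fillUp s a b q) (g := fun _ => 0) hbt
      fun u hu => fillUp_of_notMem fun h => h.2.not_gt hu.1,
    intervalIntegral.integral_congr_Ioo_of_le (f := fillUp s a b q) hab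
      fun u hu => indicator_of_mem (Ioo_subset_Ico_self hu) _]
  simp

/-- Nothing changes before `r n`. From then on all jobs are released and `d n` is the largest
deadline, so the new speed `max s q` on the window, and `0` after it, is still nonincreasing. The
property `critical` is what makes `tight` inductive: pouring may destroy the equality at an old
index, but then the plateau at level `q` supplies `n` as a new one. -/
theorem WaterFill.succ (H : WaterFill r d w n s) (hr : Monotone r) (hd : Monotone d)
    (hr0 : ∀ i, 0 ≤ r i) (hrd : ∀ i, r i < d i) {q : ℝ} (hq : 0 ≤ q)
    (hqw : ∫ u in r n..d n, max (q - s u) 0 = w n) :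
    WaterFill r d w (n + 1) fun t => s t + fillUp s (r n) (d n) q t := by
  obtain ⟨M, hM⟩ := H.bounded
  set e := fillUp s (r n) (d n) q with he
  have he0 : ∀ t, 0 ≤ e t := fillUp_nonneg _ _ _ _
  have hem : Measurable e := measurable_fillUp H.measurable _ _ _
  have heq : ∀ t, e t ≤ q := fillUp_le hq H.nonneg
  have hei := intervalIntegrable_of_bounded hem he0 heq
  set s' : ℝ → ℝ := fun t => s t + e t with hs'
  have hs'i : ∀ a b, IntervalIntegrable s' volume a b := fun a b =>
    (H.intervalIntegrable a b).add (hei a b)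
  have hI : ∀ t, ∫ u in (0)..t, s' u = (∫ u in (0)..t, s u) + ∫ u in (0)..t, e u := fun t =>
    intervalIntegral.integral_add (H.intervalIntegrable 0 t) (hei 0 t)
  have hd0 : ∀ i, 0 ≤ d i := fun i => (hr0 i).trans (hrd i).le
  have hIe0 : ∀ t, 0 ≤ t → 0 ≤ ∫ u in (0)..t, e u := fun t ht =>
    intervalIntegral.integral_nonneg_of_forall ht he0
  have hsub : ∀ a b, ∫ u in (0)..b, s' u = (∫ u in (0)..a, s' u) + ∫ u in a..b, s' u :=
    fun a b => (intervalIntegral.integral_add_adjacent_intervals (hs'i 0 a) (hs'i a b)).symm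
  have hearly : ∀ t, t < r n → s' t = s t := fun t ht => by
    simp only [hs', he, fillUp_of_notMem fun h : t ∈ Ico (r n) (d n) => h.1.not_gt ht, add_zero]
  have hIearly : ∀ t, 0 ≤ t → t ≤ r n → ∫ u in (0)..t, s' u = ∫ u in (0)..t, s u :=
    fun t ht htr => by
      rw [hI, he, integral_fillUp_eq_zero ht, add_zero]
      exact fun u hu hut => absurd (hu.1.trans_lt hut) htr.not_gt
  have hlate : ∀ t, d n ≤ t → s' t = 0 := fun t ht => by
    simp only [hs', he, fillUp_of_notMem fun h : t ∈ Ico (r n) (d n) => h.2.not_ge ht, add_zero]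
    exact H.eq_zero t fun j hj => (hd hj.le).trans ht
  have hmid : ∀ t ∈ Ico (r n) (d n), s' t = max (s t) q := fun t ht => add_fillUp_of_mem ht
  have hnonneg : ∀ t, 0 ≤ s' t := fun t => add_nonneg (H.nonneg t) (he0 t)
  have hrel : ∀ t, r n ≤ t → ∀ j < n, r j ≤ t := fun t ht j hj => (hr hj.le).trans ht
  have hanti : ∀ t u, r n ≤ t → t ≤ u → s' u ≤ s' t := by
    intro t u ht htu
    rcases lt_or_ge u (d n) with hu | hu
    · rw [hmid t ⟨ht, htu.trans_lt hu⟩, hmid u ⟨ht.trans htu, hu⟩]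
      exact max_le_max_right _ (H.antitone t u (hrel t ht) htu)
    · rw [hlate u hu]
      exact hnonneg t
  have htotal : ∀ t, d n ≤ t → ∫ u in (0)..t, s' u = ∑ j ∈ Finset.range (n + 1), w j := by
    intro t ht
    rw [hI, he, integral_fillUp_of_le H.measurable H.nonneg hq (hr0 n) (hrd n).le ht, hqw,
      H.total t ((hd0 n).trans ht) fun j hj => (hd hj.le).trans ht, Finset.sum_range_succ]
  have hmet : ∀ i < n + 1, ∑ j ∈ Finset.range (i + 1), w j ≤ ∫ u in (0)..d i, s' u := by
    intro i hi
    rcases Nat.lt_succ_iff_lt_or_eq.1 hi with hi | rfl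
    · rw [hI]
      linarith [H.met i hi, hIe0 (d i) (hd0 i)]
    · exact (htotal _ le_rfl).ge
  have hcrit : ∀ t, r n ≤ t → 0 < s' t → ∃ i < n + 1, t < d i ∧
      (∀ u ∈ Ico t (d i), s' u = s' t) ∧
        ∫ u in (0)..d i, s' u = ∑ j ∈ Finset.range (i + 1), w j := by
    intro t ht hpos
    have htd : t < d n := by
      by_contra! h
      exact hpos.ne' (hlate t h)
    -- Either the new plateau at level `q` reaches from `t` to `d n`, or `s` exceeds `q` until an
    -- old critical deadline, so nothing is poured before it and its index stays critical.
    rcases le_or_gt (s t) q with h | h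
    · refine ⟨n, n.lt_succ_self, htd, fun u hu => ?_, htotal _ le_rfl⟩
      rw [hmid u ⟨ht.trans hu.1, hu.2⟩, hmid t ⟨ht, htd⟩, max_eq_right h,
        max_eq_right ((H.antitone t u (hrel t ht) hu.1).trans h)]
    · obtain ⟨i, hi, hti, hc, hA⟩ := H.critical t ((hr0 n).trans ht) (hrel t ht) (hq.trans_lt h)
      have hge : ∀ u, r n ≤ u → u < d i → q ≤ s u := by
        intro u hu hud
        rcases le_total t u with htu | hut
        · exact h.le.trans_eq (hc u ⟨htu, hud⟩).symm
        · exact h.le.trans (H.antitone u t (hrel u hu) hut)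
      refine ⟨i, hi.trans n.lt_succ_self, hti, fun u hu => ?_, ?_⟩
      · rw [hmid u ⟨ht.trans hu.1, hu.2.trans_le (hd hi.le)⟩, hmid t ⟨ht, htd⟩,
          hc u hu]
      · rw [hI, he, integral_fillUp_eq_zero (hd0 i) fun u hu hud => hge u hu.1 hud, add_zero, hA]
  refine
    { measurable := H.measurable.add hem
      nonneg := hnonneg
      bounded := ⟨M + q, fun t => add_le_add (hM t) (heq t)⟩
      eq_zero := fun t ht => hlate t (ht n n.lt_succ_self)
      antitone := fun t u ht => hanti t u (ht n n.lt_succ_self)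
      total := fun t _ ht => htotal t (ht n n.lt_succ_self)
      met := hmet
      rate := ?_
      critical := fun t _ ht => hcrit t (ht n n.lt_succ_self)
      tight := ?_ }
  · intro t ht i hi hri htd
    rcases lt_or_ge t (r n) with htr | htr
    · rw [hIearly t ht htr.le, hearly t htr]
      rcases Nat.lt_succ_iff_lt_or_eq.1 hi with hi | rfl
      · exact H.rate t ht i hi hri htd
      · exact absurd hri htr.not_ge
    -- What is missing for job `i` at time `t` is processed before `d i`, at speed at most `s' t`.
    · have h1 := hmet i hi
      rw [hsub t] at h1
      have h2 : ∫ u in t..d i, s' u ≤ ∫ _ in t..d i, s' t :=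
        intervalIntegral.integral_mono_on htd.le (hs'i _ _) intervalIntegrable_const
          fun u hu => hanti t u htr hu.1
      rw [intervalIntegral.integral_const, smul_eq_mul, mul_comm] at h2
      linarith
  · intro t ht hpos
    rcases lt_or_ge t (r n) with htr | htr
    · rw [hearly t htr] at hpos
      rw [hIearly t ht htr.le, hearly t htr]
      obtain ⟨i, hi, h⟩ := H.tight t ht hpos
      exact ⟨i, hi.trans n.lt_succ_self, h⟩
    · obtain ⟨i, hi, hti, hc, hA⟩ := hcrit t htr hpos
      refine ⟨i, hi, (hr (Nat.lt_succ_iff.1 hi)).trans htr, hti, ?_⟩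
      have h2 : ∫ u in t..d i, s' u = ∫ _ in t..d i, s' t :=
        intervalIntegral.integral_congr_Ioo_of_le hti.le fun u hu => hc u ⟨hu.1.le, hu.2⟩
      rw [intervalIntegral.integral_const, smul_eq_mul, mul_comm] at h2
      rw [← hA, hsub t, h2]
      ring

/-- Raising a speed `s` to a level costs at most the marginal energy at that level per bit. -/
theorem add_fillUp_rpow_le {α a b q t : ℝ} (hα : 1 < α) (hq : 0 ≤ q) (hs : 0 ≤ s t) :
    (s t + fillUp s a b q t) ^ α ≤ s t ^ α + α * q ^ (α - 1) * fillUp s a b q t := by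
  by_cases ht : t ∈ Ico a b
  · rcases le_total q (s t) with h | h
    · rw [fillUp, indicator_of_mem ht, max_eq_right (by linarith)]
      simp
    · rw [add_fillUp_of_mem ht, fillUp, indicator_of_mem ht, max_eq_right h,
        max_eq_left (by linarith)]
      rcases hq.eq_or_lt with rfl | hq
      · simp [le_antisymm h hs]
      -- Bernoulli's inequality at `s t / q` is the tangent line of the power function at `q`.
      · have h1 := one_add_mul_self_le_rpow_one_add
          (show -1 ≤ s t / q - 1 by linarith [div_nonneg hs hq.le]) hα.le
        rw [add_sub_cancel, Real.div_rpow hs hq.le, le_div_iff₀ (Real.rpow_pos_of_pos hq α)] at h1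
        have h2 : q ^ α = q ^ (α - 1) * q := by
          rw [← Real.rpow_add_one hq.ne', sub_add_cancel]
        have h3 : (1 + α * (s t / q - 1)) * q ^ α
            = q ^ α + α * q ^ (α - 1) * (s t - q) := by
          rw [h2]
          field_simp
        linarith
  · rw [fillUp_of_notMem ht]
    simp

/-- `q i` is the level reached when job `i` is poured; it remains a lower bound on the window
because later jobs only add speed. The marginal bound of `add_fillUp_rpow_le` integrates to one
summand per job. -/
theorem exists_waterFill (hr : Monotone r) (hd : Monotone d)
    (hr0 : ∀ i, 0 ≤ r i) (hrd : ∀ i, r i < d i) (hw : ∀ i, 0 ≤ w i) {α T : ℝ} (hα : 1 < α)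
    (hdT : ∀ i, d i ≤ T) (n : ℕ) :
    ∃ s, WaterFill r d w n s ∧ ∃ q : ℕ → ℝ, (∀ i < n, 0 ≤ q i ∧ ∀ t ∈ Ico (r i) (d i), q i ≤ s t) ∧
      ∫ t in (0)..T, s t ^ α ≤ ∑ i ∈ Finset.range n, α * q i ^ (α - 1) * w i := by
  have hT : 0 ≤ T := (hr0 0).trans ((hrd 0).le.trans (hdT 0))
  induction n with
  | zero =>
    refine ⟨_, waterFill_zero, 0, by simp, ?_⟩
    simp [Real.zero_rpow (by linarith : α ≠ 0)]
  | succ n ih =>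
    obtain ⟨s, H, q, hq, hE⟩ := ih
    obtain ⟨M, hM⟩ := H.bounded
    obtain ⟨p, hp, hpw⟩ := exists_fill_level H.measurable H.nonneg hM (hrd n) (hw n)
    have H' := H.succ hr hd hr0 hrd hp hpw
    refine ⟨_, H', Function.update q n p, fun i hi => ?_, ?_⟩
    · rcases Nat.lt_succ_iff_lt_or_eq.1 hi with hi | rfl
      · rw [Function.update_of_ne hi.ne]
        exact ⟨(hq i hi).1, fun t ht => ((hq i hi).2 t ht).trans
          (le_add_of_nonneg_right (fillUp_nonneg _ _ _ _ _))⟩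
      · rw [Function.update_self]
        exact ⟨hp, fun t ht => (le_max_right _ _).trans_eq (add_fillUp_of_mem ht).symm⟩
    · have hpow : ∀ {f : ℝ → ℝ}, WaterFill r d w n f ∨ WaterFill r d w (n + 1) f →
          IntervalIntegrable (fun t => f t ^ α) volume 0 T := by
        intro f hf
        obtain ⟨hm, h0, M, hM⟩ : Measurable f ∧ (∀ t, 0 ≤ f t) ∧ ∃ M, ∀ t, f t ≤ M :=
          hf.elim (fun h => ⟨h.measurable, h.nonneg, h.bounded⟩)
            fun h => ⟨h.measurable, h.nonneg, h.bounded⟩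
        exact intervalIntegrable_of_bounded (M := M ^ α) (hm.pow_const α)
          (fun t => Real.rpow_nonneg (h0 t) α)
          (fun t => Real.rpow_le_rpow (h0 t) (hM t) (by linarith)) 0 T
      have hei := (intervalIntegrable_of_bounded (measurable_fillUp H.measurable (r n) (d n) p)
        (fillUp_nonneg _ _ _ _) (fillUp_le hp H.nonneg) 0 T).const_mul (α * p ^ (α - 1))
      have h1 := intervalIntegral.integral_mono hT (hpow (.inr H')) ((hpow (.inl H)).add hei)
        fun t => add_fillUp_rpow_le hα hp (H.nonneg t)
      rw [intervalIntegral.integral_add (hpow (.inl H)) hei, intervalIntegral.integral_const_mul,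
        integral_fillUp_of_le H.measurable H.nonneg hp (hr0 n) (hrd n).le (hdT n), hpw] at h1
      refine h1.trans ?_
      rw [Finset.sum_range_succ, Function.update_self]
      refine add_le_add_left (hE.trans_eq (Finset.sum_congr rfl fun i hi => ?_)) _
      rw [Function.update_of_ne (Finset.mem_range.1 hi).ne]

end WaterFilling

/-! ### Comparing primitives. -/

section Crossing

/-- If `f ≤ g` wherever the primitive of `f` exceeds that of `g`, then it never exceeds it. -/
theorem integral_le_integral_of_crossing {f g : ℝ → ℝ} {T : ℝ}
    (hf : IntervalIntegrable f volume 0 T) (hg : IntervalIntegrable g volume 0 T)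
    (h : ∀ t ∈ Ico 0 T, ∫ u in (0)..t, g u < ∫ u in (0)..t, f u → f t ≤ g t) {t : ℝ}
    (ht : t ∈ Icc 0 T) : ∫ u in (0)..t, f u ≤ ∫ u in (0)..t, g u := by
  by_contra! hlt
  have hT : 0 ≤ T := ht.1.trans ht.2
  have hsub : uIcc 0 t ⊆ uIcc 0 T := by
    rw [uIcc_of_le ht.1, uIcc_of_le hT]
    exact Icc_subset_Icc_right ht.2
  have hcont : ContinuousOn (fun v => (∫ u in (0)..v, f u) - ∫ u in (0)..v, g u) (Icc 0 t) := by
    rw [← uIcc_of_le ht.1]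
    exact ((intervalIntegral.continuousOn_primitive_interval' hf left_mem_uIcc).sub
      (intervalIntegral.continuousOn_primitive_interval' hg left_mem_uIcc)).mono hsub
  -- Take the last time `a` before `t` at which the primitive of `f` is not ahead. After `a` it is
  -- ahead, so `f ≤ g` there, and it cannot have got ahead.
  have hK : IsCompact (Icc 0 t ∩ (fun v => (∫ u in (0)..v, f u) - ∫ u in (0)..v, g u) ⁻¹' Iic 0) :=
    isCompact_Icc.of_isClosed_subset (hcont.preimage_isClosed_of_isClosed isClosed_Icc isClosed_Iic)
      inter_subset_left
  obtain ⟨a, ⟨ha, ha0⟩, hmax⟩ := hK.exists_isGreatest ⟨0, left_mem_Icc.2 ht.1, by simp⟩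
  have ha0 : (∫ u in (0)..a, f u) - ∫ u in (0)..a, g u ≤ 0 := ha0
  have hint : ∀ {e : ℝ → ℝ}, IntervalIntegrable e volume 0 T →
      IntervalIntegrable e volume 0 a ∧ IntervalIntegrable e volume a t := fun he => by
    have hat : a ∈ uIcc 0 T := by
      rw [uIcc_of_le hT]
      exact ⟨ha.1, ha.2.trans ht.2⟩
    have htt : t ∈ uIcc 0 T := by rwa [uIcc_of_le hT]
    exact ⟨he.mono_set (uIcc_subset_uIcc left_mem_uIcc hat), he.mono_set (uIcc_subset_uIcc hat htt)⟩
  have hle : ∫ u in a..t, f u ≤ ∫ u in a..t, g u := by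
    refine intervalIntegral.integral_mono_on_of_le_Ioo ha.2 (hint hf).2 (hint hg).2 fun u hu => ?_
    refine h u ⟨ha.1.trans hu.1.le, hu.2.trans_le ht.2⟩ ?_
    by_contra! hle
    exact hu.1.not_ge (hmax ⟨⟨ha.1.trans hu.1.le, hu.2.le⟩, sub_nonpos.2 hle⟩)
  rw [← intervalIntegral.integral_add_adjacent_intervals (hint hf).1 (hint hf).2,
    ← intervalIntegral.integral_add_adjacent_intervals (hint hg).1 (hint hg).2] at hlt
  linarith

/-- The part of a nondecreasing primitive that is accumulated below the level `B`. -/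
theorem integral_indicator_primitive_lt {s : ℝ → ℝ} (hs0 : ∀ u, 0 ≤ s u)
    (hs : ∀ a b, IntervalIntegrable s volume a b) {B t : ℝ} (hB : 0 ≤ B) (ht : 0 ≤ t) :
    ∫ u in (0)..t, {v | ∫ x in (0)..v, s x < B}.indicator s u = min B (∫ u in (0)..t, s u) := by
  have hmono : ∀ {a b : ℝ}, a ≤ b → ∫ u in (0)..a, s u ≤ ∫ u in (0)..b, s u := fun {a b} hab => by
    rw [← intervalIntegral.integral_add_adjacent_intervals (hs 0 a) (hs a b)]
    linarith [intervalIntegral.integral_nonneg_of_forall (μ := volume) hab hs0]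
  have hcont : Continuous fun v => ∫ u in (0)..v, s u :=
    intervalIntegral.continuous_primitive hs 0
  have hA : ∀ u, u ∈ {v | ∫ x in (0)..v, s x < B} ↔ ∫ x in (0)..u, s x < B := fun _ => Iff.rfl
  rcases lt_or_ge (∫ u in (0)..t, s u) B with h | h
  · rw [min_eq_right h.le]
    exact intervalIntegral.integral_congr_Ioo_of_le ht fun u hu =>
      indicator_of_mem ((hA u).2 ((hmono hu.2.le).trans_lt h)) s
  · rw [min_eq_left h]
    -- The first time `b` at which the primitive reaches `B` splits the integral; its value there is
    -- exactly `B`.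
    have hK : IsCompact (Icc 0 t ∩ (fun v => ∫ u in (0)..v, s u) ⁻¹' Ici B) :=
      isCompact_Icc.inter_right (isClosed_Ici.preimage hcont)
    obtain ⟨b, ⟨hb, hbB⟩, hmin⟩ := hK.exists_isLeast ⟨t, right_mem_Icc.2 ht, h⟩
    have hbB : B ≤ ∫ x in (0)..b, s x := hbB
    obtain ⟨c, hc, hcB⟩ := intermediate_value_Icc ht hcont.continuousOn
      (show B ∈ Icc _ _ from ⟨by simpa using hB, h⟩)
    have hcB : ∫ x in (0)..c, s x = B := hcB
    have hbB' : ∫ x in (0)..b, s x = B :=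
      le_antisymm ((hmono (hmin ⟨hc, hcB.ge⟩)).trans_eq hcB) hbB
    have hset : MeasurableSet {v | ∫ x in (0)..v, s x < B} :=
      measurableSet_lt hcont.measurable measurable_const
    have hint : ∀ a b, IntervalIntegrable ({v | ∫ x in (0)..v, s x < B}.indicator s) volume a b :=
      fun a b => ⟨(hs a b).1.indicator hset, (hs a b).2.indicator hset⟩
    rw [← intervalIntegral.integral_add_adjacent_intervals (hint 0 b) (hint b t),
      intervalIntegral.integral_congr_Ioo_of_le (g := s) hb.1,
      intervalIntegral.integral_congr_Ioo_of_le (g := fun _ => 0) hb.2,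
      intervalIntegral.integral_zero, hbB', add_zero]
    · exact fun u hu => indicator_of_notMem
        (fun hu' => ((hA u).1 hu').not_ge (hbB.trans (hmono hu.1.le))) s
    · refine fun u hu => indicator_of_mem ((hA u).2 ?_) s
      by_contra! hle
      exact hu.2.not_ge (hmin ⟨⟨hu.1.le, hu.2.le.trans hb.2⟩, hle⟩)

end Crossing

/-! ### Arrivals as infinite sequences. -/

section Arrivals

variable {D T Δ₀ : ℝ}

namespace Arrivals

variable (σ : Arrivals D T Δ₀)

/-- The generation times as a sequence, continued by the last one. -/
noncomputable def genSeq (k : ℕ) : ℝ :=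
  σ.gen ⟨min k σ.n, (min_le_right _ _).trans_lt (Nat.lt_succ_self _)⟩

/-- The `max 0` matters only without packets, when every term of `genSeq` is `-Δ₀`. -/
noncomputable def releaseSeq (k : ℕ) : ℝ := max 0 (σ.genSeq (k + 1))

noncomputable def deadlineSeq (k : ℕ) : ℝ := min (σ.genSeq k + D) T

noncomputable def sizeSeq (k : ℕ) : ℝ := if h : k < σ.n then σ.size ⟨k, h⟩ else 0

/-- The total size of the first `k` packets. -/
noncomputable def cum (k : ℕ) : ℝ := ∑ j ∈ Finset.range k, σ.sizeSeq j

theorem sizeSeq_nonneg (k : ℕ) : 0 ≤ σ.sizeSeq k := by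
  unfold sizeSeq
  split_ifs
  · exact (σ.size_pos _).le
  · exact le_rfl

theorem sizeSeq_val (i : Fin σ.n) : σ.sizeSeq i = σ.size i := by simp [sizeSeq]

theorem cum_zero : σ.cum 0 = 0 := rfl

theorem cum_succ (i : Fin σ.n) : σ.cum (i + 1) = σ.cum i + σ.size i := by
  rw [cum, Finset.sum_range_succ, sizeSeq_val, cum]

theorem cum_mono : Monotone σ.cum := fun _ _ h =>
  Finset.sum_le_sum_of_subset_of_nonneg (Finset.range_mono h) fun _ _ _ => σ.sizeSeq_nonneg _

theorem cum_nonneg (k : ℕ) : 0 ≤ σ.cum k := Finset.sum_nonneg fun _ _ => σ.sizeSeq_nonneg _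

theorem genSeq_mono : Monotone σ.genSeq := fun _ _ h =>
  σ.gen_mono (Fin.mk_le_mk.2 (min_le_min_right _ h))

theorem releaseSeq_mono : Monotone σ.releaseSeq := fun _ _ h =>
  max_le_max_left _ (σ.genSeq_mono (Nat.succ_le_succ h))

theorem deadlineSeq_mono : Monotone σ.deadlineSeq := fun _ _ h =>
  min_le_min_right _ (add_le_add_left (σ.genSeq_mono h) _)

theorem genSeq_succ_val (i : Fin σ.n) : σ.genSeq (i + 1) = σ.gen i.succ := by
  unfold genSeq
  congr 1
  ext
  simp [Nat.succ_le_of_lt i.2]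

theorem genSeq_val (i : Fin σ.n) : σ.genSeq i = σ.gen i.castSucc := by
  unfold genSeq
  congr 1
  ext
  simp [i.2.le]

theorem releaseSeq_val (i : Fin σ.n) : σ.releaseSeq i = σ.gen i.succ := by
  rw [releaseSeq, genSeq_succ_val, max_eq_right (σ.gen_nonneg i)]

theorem deadlineSeq_val (i : Fin σ.n) : σ.deadlineSeq i = σ.deadline i := by
  rw [deadlineSeq, genSeq_val, deadline]

theorem gen_lt_deadline (i : Fin σ.n) : σ.gen i.succ < σ.deadline i :=
  lt_min (by linarith [σ.gap_lt i]) (σ.gen_lt i)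

theorem deadline_le (i : Fin σ.n) : σ.deadline i ≤ T := min_le_right _ _

theorem deadline_mono : Monotone σ.deadline := fun i j h => by
  rw [← deadlineSeq_val, ← deadlineSeq_val]
  exact σ.deadlineSeq_mono h

theorem gen_succ_mono {i j : Fin σ.n} (h : i ≤ j) : σ.gen i.succ ≤ σ.gen j.succ :=
  σ.gen_mono (Fin.succ_le_succ_iff.2 h)

theorem releaseSeq_lt_deadlineSeq (hT : 0 < T) (hΔ₀ : 0 ≤ Δ₀) (hD : Δ₀ < D) (k : ℕ) :
    σ.releaseSeq k < σ.deadlineSeq k := by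
  rcases lt_or_ge k σ.n with h | h
  · have := σ.gen_lt_deadline ⟨k, h⟩
    rwa [← releaseSeq_val, ← deadlineSeq_val] at this
  · have hg : ∀ m, σ.n ≤ m → σ.genSeq m = σ.gen (Fin.last σ.n) := fun m hm => by
      unfold genSeq
      congr 1
      ext
      simp [hm]
    have h0 : -Δ₀ ≤ σ.gen (Fin.last σ.n) := σ.gen_zero.symm.trans_le (σ.gen_mono (Fin.zero_le _))
    have hlast : σ.gen (Fin.last σ.n) < T := by
      rcases Nat.eq_zero_or_pos σ.n with hn | hn
      · rw [show Fin.last σ.n = 0 from Fin.ext hn, σ.gen_zero]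
        linarith
      · have := σ.gen_lt ⟨σ.n - 1, by omega⟩
        rwa [show (Fin.succ ⟨σ.n - 1, by omega⟩ : Fin (σ.n + 1)) = Fin.last σ.n from
          Fin.ext (by simp; omega)] at this
    rw [releaseSeq, deadlineSeq, hg _ h, hg _ (h.trans k.le_succ), max_lt_iff, lt_min_iff,
      lt_min_iff]
    exact ⟨⟨by linarith, hT⟩, by linarith, hlast⟩

end Arrivals

end Arrivals

/-! ### In-order bit counts and the greedy rule. -/

variable {D T Δ₀ : ℝ}

namespace Arrivals

variable (σ : Arrivals D T Δ₀)

/-- A telescoping sum: each summand is what remains of packet `j` after `x` bits sent in order. -/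
theorem sum_Iic_remaining (l : Fin σ.n) {x : ℝ} (hx : 0 ≤ x) :
    ∑ j ∈ Finset.Iic l, (max (σ.cum (j + 1)) x - max (σ.cum j) x) = max (σ.cum (l + 1)) x - x := by
  have h := Finset.sum_map (Finset.Iic l) Fin.valEmbedding
    fun k : ℕ => max (σ.cum (k + 1)) x - max (σ.cum k) x
  rw [Fin.map_valEmbedding_Iic, ← Nat.range_succ_eq_Iic, Finset.sum_range_sub
    (fun k => max (σ.cum k) x), cum_zero, max_eq_right hx] at h
  exact h.symm

/-- The bits of packet `j` that remain when the first `x` bits have been transmitted. -/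
theorem size_sub_min_sub_min (j : Fin σ.n) (x : ℝ) :
    σ.size j - (min (σ.cum (j + 1)) x - min (σ.cum j) x) =
      max (σ.cum (j + 1)) x - max (σ.cum j) x := by
  have h1 := min_add_max (σ.cum (j + 1)) x
  have h2 := min_add_max (σ.cum j) x
  have h3 := σ.cum_succ j
  linarith

theorem size_le_min_sub_min_iff (j : Fin σ.n) (x : ℝ) :
    σ.size j ≤ min (σ.cum (j + 1)) x - min (σ.cum j) x ↔ σ.cum (j + 1) ≤ x := by
  have h3 := σ.cum_succ j
  have h4 := σ.size_pos j
  constructor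
  · intro h
    by_contra! hx
    rw [min_eq_right hx.le] at h
    rcases le_total (σ.cum j) x with h5 | h5
    · rw [min_eq_left h5] at h
      linarith
    · rw [min_eq_right h5] at h
      linarith
  · intro h
    rw [min_eq_left h, min_eq_left (by linarith)]
    linarith

/-- Amounts that are filled in order are determined by their sum. -/
theorem eq_min_sub_min (x : Fin σ.n → ℝ) (hx0 : ∀ i, 0 ≤ x i) (hx : ∀ i, x i ≤ σ.size i)
    (hord : ∀ k, 0 < x k → ∀ j < k, σ.size j ≤ x j) (i : Fin σ.n) :
    x i = min (σ.cum (i + 1)) (∑ j, x j) - min (σ.cum i) (∑ j, x j) := by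
  have hsplit : ∑ j, x j = ∑ j ∈ Finset.Iio i, x j + x i + ∑ j ∈ Finset.Ioi i, x j := by
    rw [← Finset.sum_add_sum_compl (Finset.Iic i),
      show (Finset.Iic i)ᶜ = Finset.Ioi i by ext; simp, ← Finset.Iio_insert,
      Finset.sum_insert Finset.notMem_Iio_self, add_comm (x i)]
  have hcum : ∑ j ∈ Finset.Iio i, σ.size j = σ.cum i := by
    have h := Finset.sum_map (Finset.Iio i) Fin.valEmbedding σ.sizeSeq
    rw [Fin.map_valEmbedding_Iio, Nat.Iio_eq_range] at h
    rw [cum, h]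
    exact Finset.sum_congr rfl fun j _ => (σ.sizeSeq_val j).symm
  have hle : ∑ j ∈ Finset.Iio i, x j ≤ σ.cum i :=
    hcum ▸ Finset.sum_le_sum fun j _ => hx j
  have hge : 0 ≤ ∑ j ∈ Finset.Ioi i, x j := Finset.sum_nonneg fun j _ => hx0 j
  -- An unfinished packet blocks all later ones, and a started one has all earlier ones finished;
  -- either way the sum pins down `x i`.
  have hlater : x i < σ.size i → ∑ j ∈ Finset.Ioi i, x j = 0 := fun h =>
    Finset.sum_eq_zero fun k hk => le_antisymm
      (not_lt.1 fun hpos => (hord k hpos i (Finset.mem_Ioi.1 hk)).not_gt h) (hx0 k)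
  have hearlier : 0 < x i → ∑ j ∈ Finset.Iio i, x j = σ.cum i := fun h =>
    hcum ▸ Finset.sum_congr rfl fun j hj =>
      le_antisymm (hx j) (hord i h j (Finset.mem_Iio.1 hj))
  have hs := σ.cum_succ i
  have hp := σ.size_pos i
  rcases (hx0 i).eq_or_lt with h0 | h0
  · have := hlater (h0 ▸ hp)
    rw [min_eq_right (by linarith), min_eq_right (by linarith)]
    linarith
  · have h1 := hearlier h0
    rw [min_eq_left (show σ.cum i ≤ _ by linarith)]
    rcases (hx i).eq_or_lt with h2 | h2
    · rw [min_eq_left (by linarith)]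
      linarith
    · have := hlater h2
      rw [min_eq_right (by linarith)]
      linarith

open Classical in
/-- The speed that the modified greedy policy uses at time `t` when the first `x` bits have been
transmitted. -/
noncomputable def greedySpeed (t x : ℝ) : ℝ :=
  ⨆ i : {i : Fin σ.n // σ.gen i.succ ≤ t ∧ x < σ.cum (i + 1)},
    (∑ j with σ.gen j.succ ≤ t ∧ σ.deadline j ≤ σ.deadline i.1,
      (max (σ.cum (j + 1)) x - max (σ.cum j) x)) / (σ.deadline i.1 - t)

theorem remaining_nonneg (j : ℕ) (x : ℝ) : 0 ≤ max (σ.cum (j + 1)) x - max (σ.cum j) x :=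
  sub_nonneg.2 (max_le_max_right _ (σ.cum_mono j.le_succ))

theorem remaining_antitone (j : ℕ) {x y : ℝ} (h : x ≤ y) :
    max (σ.cum (j + 1)) y - max (σ.cum j) y ≤ max (σ.cum (j + 1)) x - max (σ.cum j) x := by
  have hc := σ.cum_mono j.le_succ
  rcases le_total (σ.cum (j + 1)) y with h1 | h1
  · rw [max_eq_right h1, max_eq_right (hc.trans h1), sub_self]
    exact σ.remaining_nonneg j x
  · rw [max_eq_left h1, max_eq_left (h.trans h1)]
    linarith [max_le_max_left (σ.cum j) h]

open Classical in
-- With more bits processed, fewer packets are pending and less of each remains. Only packets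
-- pending at `y` need positive denominators; `hx` covers the empty supremum, which is `0`.
theorem greedySpeed_anti {t x y : ℝ} (hxy : x ≤ y)
    (hy : ∀ i : Fin σ.n, σ.gen i.succ ≤ t → y < σ.cum (i + 1) → t < σ.deadline i)
    (hx : 0 ≤ σ.greedySpeed t x) : σ.greedySpeed t y ≤ σ.greedySpeed t x := by
  refine Real.iSup_le (fun i => ?_) hx
  refine le_trans ?_ (le_ciSup (Set.finite_range _).bddAbove ⟨i.1, i.2.1, hxy.trans_lt i.2.2⟩)
  have := hy i.1 i.2.1 i.2.2
  exact div_le_div_of_nonneg_right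
    (Finset.sum_le_sum fun j _ => σ.remaining_antitone j hxy) (by linarith)

theorem _root_.PeakAoI.WaterFill.lt_deadline {s : ℝ → ℝ}
    (H : WaterFill σ.releaseSeq σ.deadlineSeq σ.sizeSeq σ.n s) {t : ℝ} (i : Fin σ.n)
    (hi : ∫ u in (0)..t, s u < σ.cum (i + 1)) : t < σ.deadline i := by
  by_contra! h
  have h1 := H.met i i.2
  rw [deadlineSeq_val] at h1
  exact (h1.trans (H.integral_mono h)).not_gt hi

-- `tight` exhibits a pending packet whose ratio reaches `s t`, and `rate` bounds all ratios by `s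
-- t`.
open Classical in
theorem _root_.PeakAoI.WaterFill.eq_greedySpeed {s : ℝ → ℝ}
    (H : WaterFill σ.releaseSeq σ.deadlineSeq σ.sizeSeq σ.n s) {t : ℝ} (ht : 0 ≤ t) :
    s t = σ.greedySpeed t (∫ u in (0)..t, s u) := by
  have hX : 0 ≤ ∫ u in (0)..t, s u := intervalIntegral.integral_nonneg_of_forall ht H.nonneg
  refine le_antisymm ?_ (Real.iSup_le (fun i => ?_) (H.nonneg t))
  · rcases (H.nonneg t).eq_or_lt with h0 | hpos
    · rw [← h0]
      refine Real.iSup_nonneg fun i => div_nonneg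
        (Finset.sum_nonneg fun j _ => σ.remaining_nonneg j _) ?_
      exact sub_nonneg.2 (H.lt_deadline σ i.1 i.2.2).le
    · obtain ⟨i, hi, hri, hti, heq⟩ := H.tight t ht hpos
      have hri' := hri
      rw [σ.releaseSeq_val ⟨i, hi⟩] at hri'
      rw [σ.deadlineSeq_val ⟨i, hi⟩] at hti heq
      have hlt : ∫ u in (0)..t, s u < σ.cum (i + 1) := by
        have := mul_pos hpos (sub_pos.2 hti)
        rw [← heq] at this
        exact sub_pos.1 this
      refine le_trans ?_ (le_ciSup (Set.finite_range _).bddAbove ⟨⟨i, hi⟩, hri', hlt⟩)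
      rw [le_div_iff₀ (sub_pos.2 hti), ← heq]
      have hsum := σ.sum_Iic_remaining ⟨i, hi⟩ hX
      rw [max_eq_left hlt.le] at hsum
      refine hsum.symm.trans_le ?_
      refine Finset.sum_le_sum_of_subset_of_nonneg (fun j hj => ?_)
        fun j _ _ => σ.remaining_nonneg j _
      rw [Finset.mem_Iic] at hj
      rw [Finset.mem_filter]
      exact ⟨Finset.mem_univ _, (σ.gen_succ_mono hj).trans hri', σ.deadline_mono hj⟩
  · obtain ⟨i, hgi, hXi⟩ := i
    have hti := H.lt_deadline σ i hXi
    have hne : (Finset.univ.filter fun j : Fin σ.n =>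
        σ.gen j.succ ≤ t ∧ σ.deadline j ≤ σ.deadline i).Nonempty :=
      ⟨i, by simp [hgi]⟩
    -- Packets after `i` may share its deadline and count in its backlog; `l` is the last such
    -- packet already generated, so `rate` is applied to `l`.
    set l := Finset.max' _ hne with hl
    have hlm := Finset.max'_mem _ hne
    rw [← hl, Finset.mem_filter] at hlm
    have hil : i ≤ l := Finset.le_max' _ _ (by simp [hgi])
    have hXl : ∫ u in (0)..t, s u < σ.cum (l + 1) :=
      hXi.trans_le (σ.cum_mono (Nat.succ_le_succ hil))
    have hdl : σ.deadline l = σ.deadline i := le_antisymm hlm.2.2 (σ.deadline_mono hil)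
    have hrate := H.rate t ht l l.2 ((σ.releaseSeq_val l).trans_le hlm.2.1)
      (by rwa [deadlineSeq_val, hdl])
    rw [deadlineSeq_val, hdl] at hrate
    rw [div_le_iff₀ (sub_pos.2 hti)]
    refine le_trans ?_ hrate
    change _ ≤ σ.cum (l + 1) - _
    rw [← max_eq_left hXl.le, ← σ.sum_Iic_remaining l hX]
    refine Finset.sum_le_sum_of_subset_of_nonneg (fun j hj => ?_)
      fun j _ _ => σ.remaining_nonneg j _
    exact Finset.mem_Iic.2 (Finset.le_max' _ _ hj)

end Arrivals

/-! ### Bits sent by a schedule. -/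

namespace Schedule

variable {σ : Arrivals D T Δ₀} (S : Schedule σ)

/-- The number of bits processed during `[0, t]`. -/
noncomputable def processed (t : ℝ) : ℝ := ∫ u in (0)..t, S.speed u

theorem sent_eq_intervalIntegral (i : Fin σ.n) {t : ℝ} (ht : 0 ≤ t) :
    S.sent i t = ∫ u in (0)..t, {u | S.serve u = some i}.indicator S.speed u := by
  rw [sent, integral_Icc_eq_integral_Ioc, intervalIntegral.integral_of_le ht]

theorem intervalIntegrable_speed (hT : 0 ≤ T) : IntervalIntegrable S.speed volume 0 T :=
  (intervalIntegrable_iff_integrableOn_Icc_of_le hT).2 S.integrable_speed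

theorem intervalIntegrable_sent (hT : 0 ≤ T) (i : Fin σ.n) :
    IntervalIntegrable ({u | S.serve u = some i}.indicator S.speed) volume 0 T :=
  (intervalIntegrable_iff_integrableOn_Icc_of_le hT).2
    (S.integrable_speed.indicator (S.measurableSet_serve i))

theorem sent_split (i : Fin σ.n) {a b : ℝ} (ha : 0 ≤ a) (hab : a ≤ b) (hb : b ≤ T) :
    S.sent i b = S.sent i a + ∫ u in a..b, {u | S.serve u = some i}.indicator S.speed u := by
  have hi := S.intervalIntegrable_sent (ha.trans (hab.trans hb)) i
  have hT : uIcc 0 T = Icc 0 T := uIcc_of_le (ha.trans (hab.trans hb))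
  rw [S.sent_eq_intervalIntegral i (ha.trans hab), S.sent_eq_intervalIntegral i ha,
    intervalIntegral.integral_add_adjacent_intervals]
  · exact hi.mono_set (uIcc_subset_uIcc left_mem_uIcc (hT ▸ ⟨ha, hab.trans hb⟩))
  · exact hi.mono_set (uIcc_subset_uIcc (hT ▸ ⟨ha, hab.trans hb⟩) (hT ▸ ⟨ha.trans hab, hb⟩))

theorem sent_mono (i : Fin σ.n) {a b : ℝ} (ha : 0 ≤ a) (hab : a ≤ b) (hb : b ≤ T) :
    S.sent i a ≤ S.sent i b := by
  rw [S.sent_split i ha hab hb]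
  exact le_add_of_nonneg_right (intervalIntegral.integral_nonneg_of_forall hab fun u =>
    indicator_nonneg (fun u _ => S.speed_nonneg u) u)

theorem Delivered.mono {S : Schedule σ} {i : Fin σ.n} {a b : ℝ} (h : S.Delivered i a) (ha : 0 ≤ a)
    (hab : a ≤ b) (hb : b ≤ T) : S.Delivered i b :=
  le_trans h (S.sent_mono i ha hab hb)

theorem sent_eq_of_not_serve (i : Fin σ.n) {a b : ℝ} (ha : 0 ≤ a) (hab : a ≤ b) (hb : b ≤ T)
    (h : ∀ u ∈ Ioo a b, S.serve u ≠ some i) : S.sent i b = S.sent i a := by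
  rw [S.sent_split i ha hab hb, intervalIntegral.integral_congr_Ioo_of_le (g := fun _ => 0) hab,
    intervalIntegral.integral_zero, add_zero]
  intro u hu
  have hu' : u ∉ {u | S.serve u = some i} := h u hu
  exact indicator_of_notMem hu' _

theorem sent_zero (i : Fin σ.n) : S.sent i 0 = 0 := by
  rw [S.sent_eq_intervalIntegral i le_rfl, intervalIntegral.integral_same]

theorem sent_nonneg (i : Fin σ.n) (t : ℝ) : 0 ≤ S.sent i t :=
  integral_nonneg fun u => indicator_nonneg (fun u _ => S.speed_nonneg u) u

/-- If `j` were incomplete at `t`, it would be so at all earlier times, and `k` would never have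
been served. -/
theorem delivered_of_sent_pos
    (hS : ∀ t ∈ Ico 0 T, ∀ i, S.serve t = some i → ∀ j < i, S.Delivered j t)
    {k : Fin σ.n} {t : ℝ} (ht : t ∈ Icc 0 T) (hk : 0 < S.sent k t) {j : Fin σ.n} (hj : j < k) :
    S.Delivered j t := by
  by_contra hnd
  have := S.sent_eq_of_not_serve k le_rfl ht.1 ht.2 fun u hu hserve =>
    hnd ((hS u ⟨hu.1.le, hu.2.trans_le ht.2⟩ k hserve j hj).mono hu.1.le hu.2.le ht.2)
  rw [this, S.sent_zero] at hk
  exact lt_irrefl _ hk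

/-- No packet receives more bits than it has if delivered packets are not served. -/
theorem sent_le_size (hS : ∀ t ∈ Ico 0 T, ∀ i, S.serve t = some i → ¬ S.Delivered i t)
    (i : Fin σ.n) {t : ℝ} (ht : t ∈ Icc 0 T) : S.sent i t ≤ σ.size i := by
  by_contra! hlt
  have hT : 0 ≤ T := ht.1.trans ht.2
  have hcont : ContinuousOn (S.sent i) (Icc 0 t) := by
    have h := (intervalIntegral.continuousOn_primitive_interval' (S.intervalIntegrable_sent hT i)
      left_mem_uIcc).mono (show Icc 0 t ⊆ _ by
        rw [uIcc_of_le hT]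
        exact Icc_subset_Icc_right ht.2)
    exact h.congr fun u hu => S.sent_eq_intervalIntegral i hu.1
  have hK : IsCompact (Icc 0 t ∩ S.sent i ⁻¹' Iic (σ.size i)) :=
    isCompact_Icc.of_isClosed_subset (hcont.preimage_isClosed_of_isClosed isClosed_Icc isClosed_Iic)
      inter_subset_left
  -- After the last time `a` without excess, the packet counts as delivered and is not served.
  obtain ⟨a, ⟨ha, ha0⟩, hmax⟩ := hK.exists_isGreatest
    ⟨0, left_mem_Icc.2 ht.1, (S.sent_zero i).trans_le (σ.size_pos i).le⟩
  have ha0 : S.sent i a ≤ σ.size i := ha0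
  rw [S.sent_eq_of_not_serve i ha.1 ha.2 ht.2] at hlt
  · exact ha0.not_gt hlt
  · intro u hu hserve
    refine hS u ⟨ha.1.trans hu.1.le, hu.2.trans_le ht.2⟩ i hserve ?_
    by_contra hnd
    exact hu.1.not_ge (hmax ⟨⟨ha.1.trans hu.1.le, hu.2.le⟩, (not_le.1 hnd).le⟩)

theorem sum_sent_eq_processed (hS : ∀ t ∈ Ico 0 T, S.serve t = none → S.speed t = 0) {t : ℝ}
    (ht : t ∈ Icc 0 T) : ∑ i, S.sent i t = S.processed t := by
  have hT : 0 ≤ T := ht.1.trans ht.2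
  simp_rw [S.sent_eq_intervalIntegral _ ht.1]
  rw [← intervalIntegral.integral_finsetSum]
  · refine intervalIntegral.integral_congr_Ioo_of_le ht.1 fun u hu => ?_
    rcases hserve : S.serve u with _ | i
    · simp [indicator, hserve, hS u ⟨hu.1.le, hu.2.trans_le ht.2⟩ hserve]
    · simp [indicator, hserve]
  · intro i _
    refine (S.intervalIntegrable_sent hT i).mono_set ?_
    rw [uIcc_of_le ht.1, uIcc_of_le hT]
    exact Icc_subset_Icc_right ht.2

/-! ### Uniqueness of the greedy speed. -/

section Greedy

variable {S}

theorem pending_iff {t : ℝ} (i : Fin σ.n)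
    (hsent : S.sent i t = min (σ.cum (i + 1)) (S.processed t) - min (σ.cum i) (S.processed t)) :
    S.Pending i t ↔ σ.gen i.succ ≤ t ∧ S.processed t < σ.cum (i + 1) := by
  rw [Pending, Delivered, hsent, σ.size_le_min_sub_min_iff, not_le]

/-- The greedy speed is determined by the number of bits processed so far. -/
theorem iSup_backlog_eq {t : ℝ} (hsent : ∀ i : Fin σ.n,
      S.sent i t = min (σ.cum (i + 1)) (S.processed t) - min (σ.cum i) (S.processed t)) :
    ⨆ i : {i // S.Pending i t}, S.backlog t (σ.deadline i) / (σ.deadline i - t) =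
      σ.greedySpeed t (S.processed t) := by
  classical
  have hp : ∀ i, S.Pending i t ↔ σ.gen i.succ ≤ t ∧ S.processed t < σ.cum (i + 1) := fun i =>
    pending_iff i (hsent i)
  refine (Equiv.subtypeEquivRight hp).iSup_congr fun i => ?_
  simp only [Equiv.subtypeEquivRight_apply_coe]
  congr 1
  rw [backlog]
  symm
  -- Delivered packets are missing from `backlog` but contribute `0` to the sum in `greedySpeed`.
  refine (Finset.sum_subset (fun j hj => ?_) fun j hj hj' => ?_).trans
    (Finset.sum_congr rfl fun j _ => by rw [hsent, σ.size_sub_min_sub_min])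
  · simp only [Finset.mem_filter, Finset.mem_univ, true_and, hp] at hj ⊢
    exact ⟨hj.1.1, hj.2⟩
  · simp only [Finset.mem_filter, Finset.mem_univ, true_and, hp] at hj hj'
    have h : σ.cum (j + 1) ≤ S.processed t := not_lt.1 fun h => hj' ⟨⟨hj.1, h⟩, hj.2⟩
    rw [hsent, σ.size_sub_min_sub_min, max_eq_right h,
      max_eq_right ((σ.cum_mono (j : ℕ).le_succ).trans h), sub_self]

/-- Deadlines increase with the index, so earliest deadline first is first-come-first-serve. -/
theorem pending_order_iff {t : ℝ} (i : Fin σ.n) :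
    (∀ j, S.Pending j t → σ.deadline i < σ.deadline j ∨ (σ.deadline i = σ.deadline j ∧ i ≤ j)) ↔
      ∀ j, S.Pending j t → i ≤ j := by
  refine forall₂_congr fun j _ => ⟨?_, fun h => ?_⟩
  · rintro (h | h)
    · exact (σ.deadline_mono.reflect_lt h).le
    · exact h.2
  · exact (σ.deadline_mono h).lt_or_eq.imp_right fun h' => ⟨h', h⟩

namespace IsModifiedGreedy

theorem serve_eq_some_iff (hS : S.IsModifiedGreedy) {t : ℝ} (ht : t ∈ Ico 0 T) (i : Fin σ.n) :
    S.serve t = some i ↔ S.Pending i t ∧ ∀ j, S.Pending j t → i ≤ j := by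
  rw [hS.serve_iff t ht, pending_order_iff]

theorem fcfs (hS : S.IsModifiedGreedy) {t : ℝ} (ht : t ∈ Ico 0 T) {i : Fin σ.n}
    (hi : S.serve t = some i) {j : Fin σ.n} (hj : j < i) : S.Delivered j t := by
  obtain ⟨hpi, hmin⟩ := (hS.serve_eq_some_iff ht i).1 hi
  by_contra hnd
  exact (hmin j ⟨(σ.gen_succ_mono hj.le).trans hpi.1, hnd⟩).not_gt hj

theorem speed_eq_zero (hS : S.IsModifiedGreedy) {t : ℝ} (ht : t ∈ Ico 0 T) (h : S.serve t = none) :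
    S.speed t = 0 := by
  classical
  have hempty : IsEmpty {i // S.Pending i t} := by
    by_contra hne
    rw [not_isEmpty_iff] at hne
    obtain ⟨i, hi⟩ := hne
    have hne : (Finset.univ.filter fun i => S.Pending i t).Nonempty := ⟨i, by simp [hi]⟩
    have hm := Finset.min'_mem _ hne
    have := (hS.serve_eq_some_iff ht (Finset.min' _ hne)).2
      ⟨(Finset.mem_filter.1 hm).2, fun j hj => Finset.min'_le _ _ (by simp [hj])⟩
    rw [h] at this
    cases this
  rw [hS.speed_eq t ht, Real.iSup_of_isEmpty]

theorem sent_eq (hS : S.IsModifiedGreedy) (i : Fin σ.n) {t : ℝ} (ht : t ∈ Icc 0 T) :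
    S.sent i t = min (σ.cum (i + 1)) (S.processed t) - min (σ.cum i) (S.processed t) := by
  rw [← S.sum_sent_eq_processed (fun t ht => hS.speed_eq_zero ht) ht]
  refine σ.eq_min_sub_min (fun i => S.sent i t) (fun i => S.sent_nonneg i t) (fun i => ?_)
    (fun k hk j hj => ?_) i
  · exact S.sent_le_size (fun u hu k hk => ((hS.serve_eq_some_iff hu k).1 hk).1.2) i ht
  · exact S.delivered_of_sent_pos (fun u hu k hk j hj => hS.fcfs hu hk hj) ht hk hj

theorem speed_eq_greedySpeed (hS : S.IsModifiedGreedy) {t : ℝ} (ht : t ∈ Ico 0 T) :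
    S.speed t = σ.greedySpeed t (S.processed t) := by
  rw [hS.speed_eq t ht, iSup_backlog_eq fun i => hS.sent_eq i (Ico_subset_Icc_self ht)]

/-- Every run of the modified greedy policy follows the water-filling speed. -/
theorem processed_eq (hS : S.IsModifiedGreedy) {s : ℝ → ℝ}
    (H : WaterFill σ.releaseSeq σ.deadlineSeq σ.sizeSeq σ.n s) (hT : 0 < T) {t : ℝ}
    (ht : t ∈ Icc 0 T) : S.processed t = ∫ u in (0)..t, s u := by
  have h1 := S.intervalIntegrable_speed hT.le
  -- Whichever of the two is ahead is, by antitonicity of the rule, not the faster one.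
  refine le_antisymm
    (integral_le_integral_of_crossing h1 (H.intervalIntegrable 0 T) (fun u hu hlt => ?_) ht)
    (integral_le_integral_of_crossing (H.intervalIntegrable 0 T) h1 (fun u hu hlt => ?_) ht)
  · rw [hS.speed_eq_greedySpeed hu, H.eq_greedySpeed σ hu.1]
    refine σ.greedySpeed_anti hlt.le (fun i _ hi => H.lt_deadline σ i (hlt.trans hi)) ?_
    rw [← H.eq_greedySpeed σ hu.1]
    exact H.nonneg u
  · rw [hS.speed_eq_greedySpeed hu, H.eq_greedySpeed σ hu.1]
    refine σ.greedySpeed_anti hlt.le (fun i _ hi => H.lt_deadline σ i hi) ?_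
    rw [← hS.speed_eq_greedySpeed hu]
    exact S.speed_nonneg u

theorem speed_eq_waterFill (hS : S.IsModifiedGreedy) {s : ℝ → ℝ}
    (H : WaterFill σ.releaseSeq σ.deadlineSeq σ.sizeSeq σ.n s) (hT : 0 < T) {t : ℝ}
    (ht : t ∈ Ico 0 T) : S.speed t = s t := by
  rw [hS.speed_eq_greedySpeed ht, hS.processed_eq H hT (Ico_subset_Icc_self ht),
    ← H.eq_greedySpeed σ ht.1]

end IsModifiedGreedy

end Greedy

end Schedule

/-! ### Existence of a greedy run. -/

theorem Arrivals.exists_waterFill (σ : Arrivals D T Δ₀) (hT : 0 < T) (hΔ₀ : 0 ≤ Δ₀) (hD : Δ₀ < D)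
    {α : ℝ} (hα : 1 < α) :
    ∃ s, WaterFill σ.releaseSeq σ.deadlineSeq σ.sizeSeq σ.n s ∧ ∃ q : ℕ → ℝ,
      (∀ i < σ.n, 0 ≤ q i ∧ ∀ t ∈ Ico (σ.releaseSeq i) (σ.deadlineSeq i), q i ≤ s t) ∧
      ∫ t in (0)..T, s t ^ α ≤
        ∑ i ∈ Finset.range σ.n, α * q i ^ (α - 1) * σ.sizeSeq i :=
  PeakAoI.exists_waterFill σ.releaseSeq_mono σ.deadlineSeq_mono (fun _ => le_max_left _ _)
    (σ.releaseSeq_lt_deadlineSeq hT hΔ₀ hD) σ.sizeSeq_nonneg hα (fun _ => min_le_right _ _) σ.n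

namespace WaterFill

variable {σ : Arrivals D T Δ₀} {s : ℝ → ℝ}

/-- Packet `i` is in turn while the processed bits lie in `[cum i, cum (i + 1))`. As a difference of
sublevel indicators, its speed can be integrated by `integral_indicator_primitive_lt`. -/
theorem serve_indicator (H : WaterFill σ.releaseSeq σ.deadlineSeq σ.sizeSeq σ.n s)
    {serve : ℝ → Option (Fin σ.n)}
    (hserve : ∀ t i, serve t = some i ↔ (σ.gen i.succ ≤ t ∧ ∫ u in (0)..t, s u < σ.cum (i + 1)) ∧
      ∀ j : Fin σ.n, σ.gen j.succ ≤ t ∧ ∫ u in (0)..t, s u < σ.cum (j + 1) → i ≤ j)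
    (i : Fin σ.n) {t : ℝ} (ht : 0 ≤ t) :
    {u | serve u = some i}.indicator s t =
      {v | ∫ x in (0)..v, s x < σ.cum (i + 1)}.indicator s t -
        {v | ∫ x in (0)..v, s x < σ.cum i}.indicator s t := by
  classical
  have hX : 0 ≤ ∫ u in (0)..t, s u := intervalIntegral.integral_nonneg_of_forall ht H.nonneg
  simp only [indicator, mem_ofPred, hserve]
  have hc := σ.cum_mono (i : ℕ).le_succ
  by_cases h1 : ∫ u in (0)..t, s u < σ.cum (i + 1)
  · by_cases h2 : ∫ u in (0)..t, s u < σ.cum i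
    · rw [if_pos h1, if_pos h2, sub_self, if_neg]
      rintro ⟨h3, h4⟩
      have hi : 0 < (i : ℕ) := by
        rw [Nat.pos_iff_ne_zero]
        intro h0
        rw [h0, σ.cum_zero] at h2
        exact hX.not_gt h2
      have hlt : (⟨i - 1, (Nat.sub_le _ _).trans_lt i.2⟩ : Fin σ.n) < i :=
        Fin.mk_lt_of_lt_val (by omega)
      refine hlt.not_ge (h4 _ ⟨(σ.gen_succ_mono hlt.le).trans h3.1, ?_⟩)
      simpa [Nat.sub_add_cancel hi] using h2
    · rw [if_pos h1, if_neg h2, sub_zero]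
      by_cases h3 : σ.gen i.succ ≤ t
      · rw [if_pos]
        refine ⟨⟨h3, h1⟩, fun j hj => ?_⟩
        by_contra! hji
        exact h2 (hj.2.trans_le (σ.cum_mono (show (j : ℕ) + 1 ≤ i from hji)))
      · rw [if_neg fun h => h3 h.1.1]
        -- Packet `i` is next but not yet generated. A positive speed would be tight for an
        -- unfinished earlier packet, so the speed is `0`.
        rcases (H.nonneg t).eq_or_lt with h0 | hpos
        · exact h0
        · obtain ⟨k, hk, hrk, htk, heq⟩ := H.tight t ht hpos
          have hki : k < i := by
            by_contra! hik
            have := σ.releaseSeq_mono hik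
            rw [σ.releaseSeq_val] at this
            exact h3 (this.trans hrk)
          have := mul_pos hpos (sub_pos.2 htk)
          rw [← heq] at this
          exact absurd ((sub_pos.1 this).trans_le (σ.cum_mono (show k + 1 ≤ i from hki))) h2
  · rw [if_neg h1, if_neg fun h => h1 h.1.2, if_neg fun h2 => h1 (h2.trans_le hc), sub_zero]

/-- The water-filling speed is the speed of a run of the modified greedy policy. -/
theorem exists_isModifiedGreedy (H : WaterFill σ.releaseSeq σ.deadlineSeq σ.sizeSeq σ.n s)
    (hT : 0 < T) :
    ∃ S : Schedule σ, S.IsModifiedGreedy := by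
  classical
  have hcont : Continuous fun v => ∫ u in (0)..v, s u :=
    intervalIntegral.continuous_primitive H.intervalIntegrable 0
  let P : Fin σ.n → ℝ → Prop := fun i t => σ.gen i.succ ≤ t ∧ ∫ u in (0)..t, s u < σ.cum (i + 1)
  let serve : ℝ → Option (Fin σ.n) := fun t =>
    if h : (Finset.univ.filter fun i => P i t).Nonempty then some (Finset.min' _ h) else none
  have hserve : ∀ t i, serve t = some i ↔ P i t ∧ ∀ j, P j t → i ≤ j := by
    intro t i
    simp only [serve]
    split_ifs with h
    · have hm := (Finset.mem_filter.1 (Finset.min'_mem _ h)).2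
      rw [Option.some_inj]
      refine ⟨?_, fun hi => le_antisymm (Finset.min'_le _ _ (by simp [hi.1])) (hi.2 _ hm)⟩
      rintro rfl
      exact ⟨hm, fun j hj => Finset.min'_le _ _ (by simp [hj])⟩
    · refine ⟨fun h' => h'.elim, fun hi => (h ⟨i, ?_⟩).elim⟩
      simp [hi.1]
  have hP : ∀ i, MeasurableSet {t | P i t} := fun i =>
    (measurableSet_le measurable_const measurable_id).inter
      (measurableSet_lt hcont.measurable measurable_const)
  let S : Schedule σ :=
    { serve := serve
      speed := s
      speed_nonneg := H.nonneg
      measurable_speed := H.measurable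
      measurableSet_serve := fun i => by
        have : {t | serve t = some i} = {t | P i t} ∩ ⋂ j, ⋂ (_ : j < i), {t | P j t}ᶜ := by
          ext t
          simp only [mem_ofPred, hserve, mem_inter_iff, mem_iInter, mem_compl_iff]
          refine and_congr_right fun _ => forall_congr' fun j => ?_
          rw [← not_lt, imp_not_comm]
        rw [this]
        exact (hP i).inter (.iInter fun j => .iInter fun _ => (hP j).compl)
      integrable_speed :=
        (intervalIntegrable_iff_integrableOn_Icc_of_le hT.le).1 (H.intervalIntegrable 0 T) }
  have hset : ∀ B, MeasurableSet {v | ∫ x in (0)..v, s x < B} := fun B =>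
    measurableSet_lt hcont.measurable measurable_const
  have hint : ∀ B a b, IntervalIntegrable ({v | ∫ x in (0)..v, s x < B}.indicator s) volume a b :=
    fun B a b => ⟨(H.intervalIntegrable a b).1.indicator (hset B),
      (H.intervalIntegrable a b).2.indicator (hset B)⟩
  have hsent : ∀ t, 0 ≤ t → ∀ i : Fin σ.n,
      S.sent i t = min (σ.cum (i + 1)) (S.processed t) - min (σ.cum i) (S.processed t) := by
    intro t ht i
    rw [S.sent_eq_intervalIntegral i ht, intervalIntegral.integral_congr_Ioo_of_le ht
      fun u hu => H.serve_indicator hserve i hu.1.le,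
      intervalIntegral.integral_sub (hint _ _ _) (hint _ _ _),
      integral_indicator_primitive_lt H.nonneg H.intervalIntegrable (σ.cum_nonneg _) ht,
      integral_indicator_primitive_lt H.nonneg H.intervalIntegrable (σ.cum_nonneg _) ht]
    rfl
  have hpend : ∀ t, 0 ≤ t → ∀ i, S.Pending i t ↔ P i t := fun t ht i =>
    Schedule.pending_iff i (hsent t ht i)
  refine ⟨S, ⟨fun t ht i => ?_, fun t ht => ?_⟩⟩
  · rw [Schedule.pending_order_iff]
    simp only [hpend t ht.1]
    exact hserve t i
  · rw [Schedule.iSup_backlog_eq (hsent t ht.1)]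
    exact H.eq_greedySpeed σ ht.1

end WaterFill

/-! ### Feasibility and deadlines. -/

namespace Schedule

variable {σ : Arrivals D T Δ₀} {S : Schedule σ}

theorem bddAbove_latest (S : Schedule σ) (t : ℝ) :
    BddAbove (insert (σ.gen 0) {g | ∃ i, S.Delivered i t ∧ σ.gen i.succ = g}) := by
  refine ((finite_range σ.gen).subset ?_).bddAbove
  rintro g (rfl | ⟨i, -, rfl⟩) <;> exact mem_range_self _

theorem gen_zero_le_latest (S : Schedule σ) (t : ℝ) : σ.gen 0 ≤ S.latest t :=
  le_csSup (S.bddAbove_latest t) (mem_insert _ _)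

theorem Delivered.gen_le_latest {i : Fin σ.n} {t : ℝ} (h : S.Delivered i t) :
    σ.gen i.succ ≤ S.latest t :=
  le_csSup (S.bddAbove_latest t) (mem_insert_of_mem _ ⟨i, h, rfl⟩)

/-- The age stays below `D` if every packet is delivered by its deadline. -/
theorem age_lt_of_delivered {t : ℝ} (ht : t ≤ T)
    (h : ∀ i, ¬ S.Delivered i t → t < σ.deadline i) : S.age t < D := by
  classical
  have hpred : ∀ k : Fin (σ.n + 1), (∀ j : Fin σ.n, j.succ ≤ k → S.Delivered j t) →
      σ.gen k ≤ S.latest t := by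
    intro k hk
    rcases Fin.eq_zero_or_eq_succ k with rfl | ⟨j, rfl⟩
    · exact S.gen_zero_le_latest t
    · exact (hk j le_rfl).gen_le_latest
  rw [age, sub_lt_comm]
  by_cases hall : ∀ i, S.Delivered i t
  · have := hpred (Fin.last σ.n) fun j _ => hall j
    linarith [σ.last_gap_lt]
  · push Not at hall
    have hne : (Finset.univ.filter fun i => ¬ S.Delivered i t).Nonempty := by
      obtain ⟨i, hi⟩ := hall
      exact ⟨i, by simp [hi]⟩
    -- All packets before the first undelivered one are delivered, so the age is at most the time
    -- since the generation of its predecessor.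
    set i := Finset.min' _ hne with hi
    have hnd : ¬ S.Delivered i t := (Finset.mem_filter.1 (Finset.min'_mem _ hne)).2
    have h1 := hpred i.castSucc fun j hj => by
      by_contra hj'
      have h2 : i ≤ j := Finset.min'_le _ _ (by simp [hj'])
      exact (Fin.succ_le_castSucc_iff.1 hj).not_ge h2
    have h3 := (h i hnd).trans_le (min_le_left _ _)
    linarith

theorem IsModifiedGreedy.feasible (hS : S.IsModifiedGreedy) (hT : 0 < T) {s : ℝ → ℝ}
    (H : WaterFill σ.releaseSeq σ.deadlineSeq σ.sizeSeq σ.n s) : S.Feasible := by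
  have hdel : ∀ t ∈ Icc 0 T, ∀ i, ¬ S.Delivered i t → t < σ.deadline i := by
    intro t ht i hi
    rw [Delivered, hS.sent_eq i ht, σ.size_le_min_sub_min_iff, not_le, hS.processed_eq H hT ht] at hi
    exact H.lt_deadline σ i hi
  refine ⟨fun t ht i hi => ((hS.serve_iff t ht i).1 hi).1.1, fun t ht i hi j hj =>
    hS.fcfs ht hi hj, fun t ht => age_lt_of_delivered ht.2 (hdel t ht), fun i => ?_⟩
  by_contra h
  exact (hdel T ⟨hT.le, le_rfl⟩ i h).not_ge (σ.deadline_le i)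

/-- An age below `D` at time `gen i.castSucc + D` requires a delivered packet strictly fresher than
the predecessor of `i`. Its index is at least `i`, and serving in order then forces `i` to be
delivered too. -/
theorem Feasible.delivered_deadline (hS : S.Feasible) (i : Fin σ.n) :
    S.Delivered i (σ.deadline i) := by
  have h0 : 0 ≤ σ.deadline i := (σ.gen_nonneg i).trans (σ.gen_lt_deadline i).le
  rcases le_total T (σ.gen i.castSucc + D) with h | h
  · rw [Arrivals.deadline, min_eq_right h]
    exact hS.all_delivered i
  · have ht : σ.deadline i ∈ Icc 0 T := ⟨h0, σ.deadline_le i⟩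
    have hage := hS.age_lt _ ht
    have hd : σ.deadline i = σ.gen i.castSucc + D := min_eq_left h
    have hlt : σ.gen i.castSucc < S.latest (σ.deadline i) := by
      rw [age] at hage
      linarith
    obtain ⟨g, hg, hlt⟩ := exists_lt_of_lt_csSup (insert_nonempty _ _) hlt
    rcases hg with rfl | ⟨k, hk, rfl⟩
    · exact absurd (σ.gen_mono (Fin.zero_le _)) hlt.not_ge
    · have hik : i ≤ k := by
        by_contra! hki
        exact hlt.not_ge (σ.gen_mono (Fin.succ_le_castSucc_iff.2 hki))
      rcases hik.eq_or_lt with rfl | hik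
      · exact hk
      · exact S.delivered_of_sent_pos hS.fcfs ht ((σ.size_pos k).trans_le hk) hik

end Schedule

/-! ### Energy comparison. -/

theorem lintegral_Icc_ofReal_eq {f : ℝ → ℝ} {T : ℝ} (hT : 0 ≤ T)
    (hf : IntervalIntegrable f volume 0 T) (hf0 : ∀ t, 0 ≤ f t) :
    ∫⁻ t in Icc 0 T, ENNReal.ofReal (f t) = ENNReal.ofReal (∫ t in (0)..T, f t) := by
  rw [intervalIntegral.integral_of_le hT, ← integral_Icc_eq_integral_Ioc,
    ofReal_integral_eq_lintegral_ofReal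
      ((intervalIntegrable_iff_integrableOn_Icc_of_le hT).1 hf) (.of_forall hf0)]

theorem WaterFill.intervalIntegrable_rpow {r d w : ℕ → ℝ} {n : ℕ} {s : ℝ → ℝ}
    (H : WaterFill r d w n s) {α : ℝ} (hα : 0 ≤ α) (a b : ℝ) :
    IntervalIntegrable (fun t => s t ^ α) volume a b :=
  let ⟨M, hM⟩ := H.bounded
  intervalIntegrable_of_bounded (M := M ^ α) (H.measurable.pow_const α)
    (fun t => Real.rpow_nonneg (H.nonneg t) α)
    (fun t => Real.rpow_le_rpow (H.nonneg t) (hM t) hα) a b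

theorem Schedule.IsModifiedGreedy.energy_eq {σ : Arrivals D T Δ₀} {S : Schedule σ}
    (hS : S.IsModifiedGreedy) (hT : 0 < T) {s : ℝ → ℝ}
    (H : WaterFill σ.releaseSeq σ.deadlineSeq σ.sizeSeq σ.n s) {α : ℝ} (hα : 0 ≤ α) :
    S.energy (fun s => s ^ α) = ENNReal.ofReal (∫ t in (0)..T, s t ^ α) := by
  rw [← lintegral_Icc_ofReal_eq hT.le (H.intervalIntegrable_rpow hα 0 T)
    fun t => Real.rpow_nonneg (H.nonneg t) α, Schedule.energy,
    ← Measure.restrict_congr_set Ico_ae_eq_Icc]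
  exact setLIntegral_congr_fun measurableSet_Ico fun t ht => by
    simp only [hS.speed_eq_waterFill H hT ht]

/-- Young's inequality for `α * y` and `s ^ (α - 1)` with exponents `α` and `α / (α - 1)`. The
coefficient of `s ^ α` falls short of `1` by `1 / α`, which permits absorption. -/
theorem mul_rpow_mul_le {α s y : ℝ} (hα : 1 < α) (hs : 0 ≤ s) (hy : 0 ≤ y) :
    α * s ^ (α - 1) * y ≤ (1 - 1 / α) * s ^ α + α ^ α / α * y ^ α := by
  have h0 : 0 < α := by linarith
  have h1 : α - 1 ≠ 0 := by linarith
  have h := Real.young_inequality_of_nonneg (mul_nonneg h0.le hy) (Real.rpow_nonneg hs (α - 1))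
    (Real.HolderConjugate.conjExponent hα)
  rw [Real.conjExponent, ← Real.rpow_mul hs, mul_div_cancel₀ _ h1, Real.mul_rpow h0.le hy] at h
  calc α * s ^ (α - 1) * y = α * y * s ^ (α - 1) := by ring
    _ ≤ _ := h
    _ = _ := by field_simp; ring

/-- The energy of the water-filling speed is at most `α ^ α` times that of any feasible policy. -/
theorem WaterFill.integral_rpow_le {σ : Arrivals D T Δ₀} {s : ℝ → ℝ}
    (H : WaterFill σ.releaseSeq σ.deadlineSeq σ.sizeSeq σ.n s) (hT : 0 < T) {α : ℝ} (hα : 1 < α)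
    {q : ℕ → ℝ}
    (hq : ∀ i < σ.n, 0 ≤ q i ∧ ∀ t ∈ Ico (σ.releaseSeq i) (σ.deadlineSeq i), q i ≤ s t)
    (hE : ∫ t in (0)..T, s t ^ α ≤
      ∑ i ∈ Finset.range σ.n, α * q i ^ (α - 1) * σ.sizeSeq i)
    {S : Schedule σ} (hS : S.Feasible)
    (hint : IntervalIntegrable (fun t => S.speed t ^ α) volume 0 T) :
    ∫ t in (0)..T, s t ^ α ≤ α ^ α * ∫ t in (0)..T, S.speed t ^ α := by
  have h0 : 0 < α := by linarith
  have hIH := H.intervalIntegrable_rpow h0.le 0 T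
  -- The speed spent on packet `i` before its deadline. The cut is needed because feasibility does
  -- not forbid serving a delivered packet, and `q i ≤ s` is known only inside the window.
  let h : Fin σ.n → ℝ → ℝ := fun i =>
    (Iio (σ.deadline i)).indicator ({u | S.serve u = some i}.indicator S.speed)
  have hd0 : ∀ i, 0 ≤ σ.deadline i := fun i =>
    (σ.gen_nonneg i).trans (σ.gen_lt_deadline i).le
  have hh : ∀ i, IntervalIntegrable (h i) volume 0 T := fun i =>
    ⟨(S.intervalIntegrable_sent hT.le i).1.indicator measurableSet_Iio,
      (S.intervalIntegrable_sent hT.le i).2.indicator measurableSet_Iio⟩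
  have hsize : ∀ i, σ.size i ≤ ∫ u in (0)..T, h i u := by
    intro i
    have hmem : σ.deadline i ∈ uIcc 0 T := by
      rw [uIcc_of_le hT.le]
      exact ⟨hd0 i, σ.deadline_le i⟩
    rw [← intervalIntegral.integral_add_adjacent_intervals
      ((hh i).mono_set (uIcc_subset_uIcc left_mem_uIcc hmem))
      ((hh i).mono_set (uIcc_subset_uIcc hmem right_mem_uIcc)),
      intervalIntegral.integral_congr_Ioo_of_le (f := h i) (hd0 i)
        fun u hu => indicator_of_mem (mem_Iio.2 hu.2) _,
      intervalIntegral.integral_congr_Ioo_of_le (f := h i) (g := fun _ => 0) (σ.deadline_le i)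
        fun u hu => indicator_of_notMem (notMem_Iio.2 hu.1.le) _,
      intervalIntegral.integral_zero, add_zero, ← S.sent_eq_intervalIntegral i (hd0 i)]
    exact hS.delivered_deadline i
  have hpt : ∀ u ∈ Ioo 0 T, ∑ i : Fin σ.n, α * q i ^ (α - 1) * h i u ≤
      (1 - 1 / α) * s u ^ α + α ^ α / α * S.speed u ^ α := by
    intro u hu
    have hrhs := mul_rpow_mul_le hα (H.nonneg u) (S.speed_nonneg u)
    have hpos : 0 ≤ α * s u ^ (α - 1) * S.speed u :=
      mul_nonneg (mul_nonneg h0.le (Real.rpow_nonneg (H.nonneg u) _)) (S.speed_nonneg u)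
    rcases hserve : S.serve u with _ | i
    · refine le_trans (le_of_eq (Finset.sum_eq_zero fun i _ => ?_)) (hpos.trans hrhs)
      simp [h, indicator, hserve]
    · rw [Finset.sum_eq_single i (fun j _ hj => by simp [h, indicator, hserve, hj.symm])
        fun hi => absurd (Finset.mem_univ i) hi]
      by_cases hud : u < σ.deadline i
      · have hui := hS.available u ⟨hu.1.le, hu.2⟩ i hserve
        obtain ⟨hq0, hqs⟩ := hq i i.2
        have hle := hqs u ⟨(σ.releaseSeq_val i).trans_le hui, hud.trans_eq (σ.deadlineSeq_val i).symm⟩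
        have hhu : h i u = S.speed u := by simp [h, indicator, hserve, hud]
        rw [hhu]
        refine le_trans (mul_le_mul_of_nonneg_right (mul_le_mul_of_nonneg_left
          (Real.rpow_le_rpow hq0 hle (by linarith)) h0.le) (S.speed_nonneg u)) hrhs
      · have hhu : h i u = 0 := by simp [h, hud]
        rw [hhu, mul_zero]
        exact hpos.trans hrhs
  have hmain : ∫ t in (0)..T, s t ^ α ≤
      (1 - 1 / α) * (∫ t in (0)..T, s t ^ α) + α ^ α / α * ∫ t in (0)..T, S.speed t ^ α :=
    calc ∫ t in (0)..T, s t ^ α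
        ≤ ∑ i : Fin σ.n, α * q i ^ (α - 1) * σ.size i := by
          refine hE.trans_eq ?_
          rw [Finset.sum_range]
          simp only [σ.sizeSeq_val]
      _ ≤ ∑ i : Fin σ.n, α * q i ^ (α - 1) * ∫ u in (0)..T, h i u :=
          Finset.sum_le_sum fun i _ => mul_le_mul_of_nonneg_left (hsize i)
            (mul_nonneg h0.le (Real.rpow_nonneg (hq i i.2).1 _))
      _ = ∫ u in (0)..T, ∑ i : Fin σ.n, α * q i ^ (α - 1) * h i u := by
          rw [intervalIntegral.integral_finsetSum fun i _ => (hh i).const_mul _]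
          simp only [intervalIntegral.integral_const_mul]
      _ ≤ ∫ u in (0)..T, ((1 - 1 / α) * s u ^ α + α ^ α / α * S.speed u ^ α) :=
          intervalIntegral.integral_mono_on_of_le_Ioo hT.le
            (by simpa only [Finset.sum_fn] using IntervalIntegrable.sum Finset.univ fun i _ =>
              (hh i).const_mul (α * q i ^ (α - 1)))
            ((hIH.const_mul _).add (hint.const_mul _)) hpt
      _ = _ := by
          rw [intervalIntegral.integral_add (hIH.const_mul _) (hint.const_mul _),
            intervalIntegral.integral_const_mul, intervalIntegral.integral_const_mul]
  have h1 : (∫ t in (0)..T, s t ^ α) / α ≤ (α ^ α * ∫ t in (0)..T, S.speed t ^ α) / α := by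
    rw [sub_mul, one_mul, one_div_mul_eq_div, div_mul_eq_mul_div] at hmain
    linarith
  exact (div_le_div_iff_of_pos_right h0).1 h1

end PeakAoI

theorem mainTheorem5 (α D T Δ₀ : ℝ) (hα : 1 < α) (hT : 0 < T) (hΔ₀ : 0 ≤ Δ₀) (hD : Δ₀ < D) :
    (∀ σ : PeakAoI.Arrivals D T Δ₀,
      (PeakAoI.modifiedGreedy σ).Nonempty ∧
        ∀ S ∈ PeakAoI.modifiedGreedy σ, S.Feasible ∧ S.energy (fun s => s ^ α) < ⊤) ∧
    PeakAoI.competitiveRatio (fun s => s ^ α)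
      (PeakAoI.modifiedGreedy : ∀ σ : PeakAoI.Arrivals D T Δ₀, Set (PeakAoI.Schedule σ)) ≤
        ENNReal.ofReal (α ^ α) := by
  have h0 : 0 < α := by linarith
  have hαα : 0 < α ^ α := Real.rpow_pos_of_pos h0 α
  refine ⟨fun σ => ?_, iSup_le fun σ => iSup_le fun S => iSup_le fun hS => ?_⟩
  · obtain ⟨s, H, -⟩ := σ.exists_waterFill hT hΔ₀ hD hα
    refine ⟨H.exists_isModifiedGreedy hT, fun S hS => ?_⟩
    have hS : S.IsModifiedGreedy := hS
    exact ⟨hS.feasible hT H, (hS.energy_eq hT H h0.le).trans_lt ENNReal.ofReal_lt_top⟩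
  · have hS : S.IsModifiedGreedy := hS
    obtain ⟨s, H, q, hq, hE⟩ := σ.exists_waterFill hT hΔ₀ hD hα
    refine ENNReal.div_le_of_le_mul ?_
    have hne : ENNReal.ofReal (α ^ α) ≠ 0 := (ENNReal.ofReal_pos.2 hαα).ne'
    rw [PeakAoI.offlineEnergy, ENNReal.mul_iInf_of_ne hne ENNReal.ofReal_ne_top]
    refine le_iInf fun S' => ?_
    rw [ENNReal.mul_iInf_of_ne hne ENNReal.ofReal_ne_top]
    refine le_iInf fun hS' => ?_
    -- Finite energy is what makes the power of the competing speed integrable.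
    by_cases htop : S'.energy (fun s => s ^ α) = ⊤
    · rw [htop, ENNReal.mul_top hne]
      exact le_top
    · have hpow : ∀ t, 0 ≤ S'.speed t ^ α := fun t => Real.rpow_nonneg (S'.speed_nonneg t) α
      have hint : IntervalIntegrable (fun t => S'.speed t ^ α) MeasureTheory.volume 0 T :=
        (intervalIntegrable_iff_integrableOn_Icc_of_le hT.le).2
          ((MeasureTheory.lintegral_ofReal_ne_top_iff_integrable
            (S'.measurable_speed.pow_const α).aestronglyMeasurable (.of_forall hpow)).1 htop)
      rw [hS.energy_eq hT H h0.le, PeakAoI.Schedule.energy,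
        PeakAoI.lintegral_Icc_ofReal_eq hT.le hint hpow, ← ENNReal.ofReal_mul hαα.le]
      exact ENNReal.ofReal_le_ofReal (H.integral_rpow_le hT hα hq hE hS' hint)
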